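/- Let $X_A\subset\{0,\dots,5\}^{\mathbb N}$ be the one-sided subshift of finite type, with shift map $f$, given by the transition matrix \[ A=\begin{pmatrix}1&1&1&0&0&0\\1&1&1&0&0&0\\1&1&1&1&1&1\\0&0&0&1&1&1\\0&0&0&1&1&1\\1&1&1&1&1&1\end{pmatrix}. \] Let $w_1=(0,0)$, $w_2=(1,0)$, $w_3=(1/2,1)$, let $\Delta\subset\mathbb R^2$ be the triangle with vertices $w_1,w_2,w_3$, and let $F=[w_1,w_2]$, $v_1=(1/4,0)$, $v_2=(3/4,0)$. Write $\mathcal C_2(ab)$ for the set of sequences in $X_A$ that start with $ab$, and define $\Phi:X_A\to\mathbb R^2$ by $\Phi=w_1$ on $\mathcal C_2(00)\cup\mathcal C_2(01)\cup\mathcal C_2(10)\cup\mathcal C_2(44)$, $\Phi=w_2$ on $\mathcal C_2(33)\cup\mathcal C_2(34)\cup\mathcal C_2(43)\cup\mathcal C_2(11)$, and $\Phi=w_3$ otherwise. Let $\mathcal M$ be the set of $f$-invariant Borel probability measures on $X_A$, let ${\rm rv}(\mu)=\int\Phi\,d\mu$ for $\mu\in\mathcal M$, let ${\rm Rot}(\Phi)=\{{\rm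 rv}(\mu):\mu\in\mathcal M\}$, and for $w\in{\rm Rot}(\Phi)$ let $\mathcal H(w)=\sup\{h_\mu(f):\mu\in\mathcal M,\ {\rm rv}(\mu)=w\}$, where $h_\mu(f)$ is the measure-theoretic entropy. Then ${\rm Rot}(\Phi)=\Delta$, and $F$ is a face of ${\rm Rot}(\Phi)$ (its intersection with a supporting hyperplane). Moreover $\mathcal H(w)=\log 2$ for all $w\in[v_1,v_2]$, and $\mathcal H(w)<\log 2$ for all $w\in F\setminus[v_1,v_2]$. Consequently $\mathcal H|_F$ is not real-analytic on the relative interior of $F$. -/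

import Mathlib

open scoped ENNReal

namespace RotEntropy

section Entropy

/-- Shannon entropy (natural logarithm) of the finite partition of `α` into the fibres of `P`. -/
noncomputable def partitionEntropy {α ι : Type*} [MeasurableSpace α] [Fintype ι]
    (μ : MeasureTheory.Measure α) (P : α → ι) : ℝ :=
  ∑ i, Real.negMulLog (μ.real (P ⁻¹' {i}))

/-- The map whose fibres form the join of the partitions `P, T⁻¹ P, …, T^{-(n-1)} P`. -/
def itinerary {α ι : Type*} (T : α → α) (P : α → ι) (n : ℕ) : α → (Fin n → ι) :=
  fun x i => P (T^[(i : ℕ)] x)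

/-- `h_μ(T, P) = lim (1/n) H_μ(P ∨ T⁻¹ P ∨ … ∨ T^{-(n-1)} P)`; the limit exists for invariant
probability measures, so that it coincides with the upper limit used here. -/
noncomputable def entropyOfPartition {α : Type*} [MeasurableSpace α]
    (μ : MeasureTheory.Measure α) (T : α → α) {k : ℕ} (P : α → Fin k) : ℝ≥0∞ :=
  Filter.limsup
    (fun n : ℕ => ENNReal.ofReal (partitionEntropy μ (itinerary T P n) / (n : ℝ))) Filter.atTop

/-- The Kolmogorov–Sinai (measure-theoretic) entropy `h_μ(T)`: the supremum of `h_μ(T, P)` over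
all finite measurable partitions `P`. -/
noncomputable def metricEntropy {α : Type*} [MeasurableSpace α]
    (μ : MeasureTheory.Measure α) (T : α → α) : ℝ≥0∞ :=
  ⨆ (k : ℕ) (P : α → Fin k) (_ : Measurable P), entropyOfPartition μ T P

end Entropy

section Shift

/-- The one-sided subshift of finite type `X_A` (sequences are indexed from `0`). As a type it
carries the subspace topology and σ-algebra of the product `ℕ → Fin d`. -/
def SFT {d : ℕ} (A : Matrix (Fin d) (Fin d) ℕ) : Set (ℕ → Fin d) :=
  {x | ∀ n, A (x n) (x (n + 1)) = 1}

/-- The shift map `f : X_A → X_A`, `f(x)_n = x_{n+1}`. -/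
def shift {d : ℕ} (A : Matrix (Fin d) (Fin d) ℕ) (x : SFT A) : SFT A :=
  ⟨fun n => x.1 (n + 1), fun n => x.2 (n + 1)⟩

/-- The cylinder `C_k(t)` in `X_A` generated by the block `t` of length `k`. -/
def cyl {d : ℕ} (A : Matrix (Fin d) (Fin d) ℕ) {k : ℕ} (t : Fin k → Fin d) : Set (SFT A) :=
  {x | ∀ i : Fin k, x.1 i = t i}

/-- The set of shift-invariant Borel probability measures on `X_A`. -/
def invMeasures {d : ℕ} (A : Matrix (Fin d) (Fin d) ℕ) : Set (MeasureTheory.Measure (SFT A)) :=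
  {μ | MeasureTheory.IsProbabilityMeasure μ ∧ MeasureTheory.MeasurePreserving (shift A) μ μ}

/-- The rotation vector `rv(μ) = (∫ φ₁ dμ, …, ∫ φ_m dμ)`. -/
noncomputable def rv {d m : ℕ} {A : Matrix (Fin d) (Fin d) ℕ}
    (Φ : SFT A → EuclideanSpace ℝ (Fin m)) (μ : MeasureTheory.Measure (SFT A)) :
    EuclideanSpace ℝ (Fin m) :=
  WithLp.toLp 2 (fun i => ∫ x, Φ x i ∂μ)

/-- The generalized rotation set `Rot(Φ)`. -/
def Rot {d m : ℕ} {A : Matrix (Fin d) (Fin d) ℕ}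
    (Φ : SFT A → EuclideanSpace ℝ (Fin m)) : Set (EuclideanSpace ℝ (Fin m)) :=
  {w | ∃ μ ∈ invMeasures A, rv Φ μ = w}

/-- The localized entropy `H(w) = sup {h_μ(f) : μ invariant, rv(μ) = w}`. -/
noncomputable def localizedEntropy {d m : ℕ} {A : Matrix (Fin d) (Fin d) ℕ}
    (Φ : SFT A → EuclideanSpace ℝ (Fin m)) (w : EuclideanSpace ℝ (Fin m)) : ℝ≥0∞ :=
  ⨆ μ ∈ {μ | μ ∈ invMeasures A ∧ rv Φ μ = w}, metricEntropy μ (shift A)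

end Shift

/-- `F` is a (non-empty) face of `K`: the intersection of `K` with a supporting hyperplane. -/
def IsFace {m : ℕ} (K F : Set (EuclideanSpace ℝ (Fin m))) : Prop :=
  F.Nonempty ∧ ∃ (α : EuclideanSpace ℝ (Fin m)) (a : ℝ), α ≠ 0 ∧
    (∀ u ∈ K, inner ℝ α u ≤ a) ∧ F = {u ∈ K | inner ℝ α u = a}

section Example

/-- The transition matrix. -/
def A : Matrix (Fin 6) (Fin 6) ℕ :=
  !![1, 1, 1, 0, 0, 0;
     1, 1, 1, 0, 0, 0;
     1, 1, 1, 1, 1, 1;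
     0, 0, 0, 1, 1, 1;
     0, 0, 0, 1, 1, 1;
     1, 1, 1, 1, 1, 1]

noncomputable def w₁ : EuclideanSpace ℝ (Fin 2) := !₂[0, 0]
noncomputable def w₂ : EuclideanSpace ℝ (Fin 2) := !₂[1, 0]
noncomputable def w₃ : EuclideanSpace ℝ (Fin 2) := !₂[1 / 2, 1]
noncomputable def v₁ : EuclideanSpace ℝ (Fin 2) := !₂[1 / 4, 0]
noncomputable def v₂ : EuclideanSpace ℝ (Fin 2) := !₂[3 / 4, 0]

open Classical in
/-- The potential, constant on cylinders of length two. -/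
noncomputable def Φ (ξ : SFT A) : EuclideanSpace ℝ (Fin 2) :=
  if ξ ∈ cyl A ![0, 0] ∪ cyl A ![0, 1] ∪ cyl A ![1, 0] ∪ cyl A ![4, 4] then w₁
  else if ξ ∈ cyl A ![3, 3] ∪ cyl A ![3, 4] ∪ cyl A ![4, 3] ∪ cyl A ![1, 1] then w₂
  else w₃

/-- The triangle with vertices `w₁, w₂, w₃`. -/
noncomputable def triangle : Set (EuclideanSpace ℝ (Fin 2)) := convexHull ℝ {w₁, w₂, w₃}

/-- The line segment with endpoints `w₁, w₂`. -/
noncomputable def F : Set (EuclideanSpace ℝ (Fin 2)) := segment ℝ w₁ w₂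

end Example

end RotEntropy

/-!
The potential depends on two symbols only and takes the values `w₁`, `w₂`, `w₃`, so every rotation
vector is a convex combination of these three points; conversely, the fixed points `000…`, `333…`
and `222…` realise the three vertices, and invariant measures may be mixed. Hence the rotation set
is the triangle (`Rot_Φ_eq_triangle`).

A measure with rotation vector on the lower side gives no mass to pairs with potential `w₃`, so it
lives on the two full shifts over `{0, 1}` and over `{3, 4}`. Each of them has entropy at most
`log 2`, with equality only for the `(1/2, 1/2)`-Bernoulli measure, whose rotation vector is `v₁`
and `v₂` respectively. Mixtures of the two Bernoulli measures give cylinders of length `n` mass at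
most `2⁻ⁿ`, so their entropy is at least `log 2`; this is the lower bound on `[v₁, v₂]`
(`log_two_le_localizedEntropy`).

The upper bound is a form of the variational inequality: if `M` is a positive matrix and `u` a
positive vector with `M u ≤ Λ u`, then `h_μ(f) ≤ log Λ - ∫ log M (x₀, x₁) dμ`
(`metricEntropy_le_of_generator`). As the entropy is a supremum over all finite measurable
partitions `P`, this includes that the partition into one-cylinders is a generator. Both facts come
at once from Gibbs' inequality: the `P`-names of length `n` are compared with a weight that codes
the symbol sequence by the Markov weights of `M` and predicts each `P`-label from finitely many
symbols, where an error in the prediction is rare by density of the cylinder sets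
(`exists_cylinder_approx`). For `M` one takes `1` on pairs with potential `w₁`, `1 + s` on pairs with
potential `w₂`, and a weight tending to zero elsewhere. With `s = 0` this yields `log 2` everywhere
on the side; off `[v₁, v₂]`, a small `s` of the right sign yields a bound below `log 2`
(`localizedEntropy_lt_log_two`). Non-analyticity follows by the identity theorem.
-/

namespace RotEntropy

open MeasureTheory Filter Topology

/-! ### Gibbs' inequality for partitions -/

section Gibbs

lemma negMulLog_sum_le {β : Type*} (s : Finset β) (p : β → ℝ) (hp : ∀ b, 0 ≤ p b) :
    Real.negMulLog (∑ b ∈ s, p b) ≤ ∑ b ∈ s, Real.negMulLog (p b) := by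
  simp only [Real.negMulLog, neg_mul, Finset.sum_mul, Finset.sum_neg_distrib, neg_le_neg_iff]
  refine Finset.sum_le_sum fun b hb => ?_
  rcases (hp b).eq_or_lt with h | h
  · simp [← h]
  · exact mul_le_mul_of_nonneg_left
      (Real.log_le_log h (Finset.single_le_sum (fun i _ => hp i) hb)) h.le

lemma negMulLog_le_mul_add_exp {p : ℝ} (hp : 0 ≤ p) (g : ℝ) :
    Real.negMulLog p ≤ p * g + Real.exp (-g) - p := by
  rcases hp.eq_or_lt with rfl | h
  · simpa using Real.exp_nonneg _
  · have h1 := Real.log_le_sub_one_of_pos (div_pos (Real.exp_pos (-g)) h)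
    rw [Real.log_div (Real.exp_pos _).ne' h.ne', Real.log_exp] at h1
    have h2 := mul_le_mul_of_nonneg_left h1 h.le
    have h3 : p * (Real.exp (-g) / p - 1) = Real.exp (-g) - p := by field_simp
    rw [h3] at h2
    rw [Real.negMulLog]
    linarith

variable {α : Type*} [MeasurableSpace α] {μ : Measure α} [IsProbabilityMeasure μ]

lemma integrable_comp_of_finite {β : Type*} [Finite β] [MeasurableSpace β]
    [MeasurableSingletonClass β] {Y : α → β} (hY : Measurable Y) (G : β → ℝ) :
    Integrable (fun x => G (Y x)) μ := by
  have : IsProbabilityMeasure (μ.map Y) := Measure.isProbabilityMeasure_map hY.aemeasurable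
  exact (Integrable.of_finite (f := G) (μ := μ.map Y)).comp_measurable hY

lemma integral_comp_eq_sum {β : Type*} [Fintype β] [MeasurableSpace β]
    [MeasurableSingletonClass β] {Y : α → β} (hY : Measurable Y) (G : β → ℝ) :
    ∫ x, G (Y x) ∂μ = ∑ b, μ.real (Y ⁻¹' {b}) * G b := by
  have : IsProbabilityMeasure (μ.map Y) := Measure.isProbabilityMeasure_map hY.aemeasurable
  rw [← integral_map hY.aemeasurable (measurable_of_finite G).aestronglyMeasurable,
    integral_fintype Integrable.of_finite]
  refine Finset.sum_congr rfl fun b _ => ?_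
  rw [map_measureReal_apply hY (measurableSet_singleton b), smul_eq_mul]

/-- Gibbs' inequality, in a form that also allows passing to a coarser partition: if the weights
`exp (-G b)` sum to at most one, then the entropy of `f ∘ Y` is at most the mean of `G ∘ Y`. -/
lemma partitionEntropy_comp_le_integral {β ι : Type*} [Fintype β] [MeasurableSpace β]
    [MeasurableSingletonClass β] [Fintype ι] {Y : α → β} (hY : Measurable Y) (f : β → ι)
    (G : β → ℝ) (hG : ∑ b, Real.exp (-G b) ≤ 1) :
    partitionEntropy μ (fun x => f (Y x)) ≤ ∫ x, G (Y x) ∂μ := by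
  classical
  have hfib : ∀ i, μ.real ((fun x => f (Y x)) ⁻¹' {i}) =
      ∑ b with f b = i, μ.real (Y ⁻¹' {b}) := by
    intro i
    rw [sum_measureReal_preimage_singleton _ fun b _ => hY (measurableSet_singleton b)]
    congr 1
    ext x
    simp
  have hone : ∑ b, μ.real (Y ⁻¹' {b}) = 1 := by
    rw [sum_measureReal_preimage_singleton _ fun b _ => hY (measurableSet_singleton b)]
    simp
  calc partitionEntropy μ (fun x => f (Y x))
      ≤ ∑ i, ∑ b with f b = i, Real.negMulLog (μ.real (Y ⁻¹' {b})) := by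
        refine Finset.sum_le_sum fun i _ => ?_
        rw [hfib]
        exact negMulLog_sum_le _ _ fun _ => measureReal_nonneg
    _ = ∑ b, Real.negMulLog (μ.real (Y ⁻¹' {b})) :=
        Finset.sum_fiberwise _ _ _
    _ ≤ ∑ b, (μ.real (Y ⁻¹' {b}) * G b + Real.exp (-G b) - μ.real (Y ⁻¹' {b})) :=
        Finset.sum_le_sum fun b _ => negMulLog_le_mul_add_exp measureReal_nonneg _
    _ ≤ ∫ x, G (Y x) ∂μ := by
        rw [Finset.sum_sub_distrib, Finset.sum_add_distrib, hone, integral_comp_eq_sum hY]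
        linarith

end Gibbs

/-! ### Markov weights and predictions -/

section Weights

/-- The total weight of the words of length `N + 1` for a positive matrix `M` with a
superharmonic vector `u`. -/
lemma sum_markovWeight_le {ι : Type*} [Fintype ι] {M : ι → ι → ℝ} {u : ι → ℝ} {Λ : ℝ}
    (hM : ∀ i j, 0 < M i j) (hΛ : 0 ≤ Λ)
    (hMu : ∀ i, ∑ j, M i j * u j ≤ Λ * u i) (N : ℕ) :
    ∑ w : Fin (N + 1) → ι, (∏ i : Fin N, M (w i.castSucc) (w i.succ)) * u (w (Fin.last N)) ≤
      Λ ^ N * ∑ i, u i := by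
  induction N with
  | zero =>
    simp only [Finset.univ_eq_empty, Finset.prod_empty, one_mul, pow_zero]
    rw [← (Equiv.funUnique (Fin 1) ι).symm.sum_comp]
    simp
  | succ N ih =>
    rw [← (Fin.snocEquiv (fun _ : Fin (N + 2) => ι)).sum_comp, Fintype.sum_prod_type_right]
    calc _ = ∑ w : Fin (N + 1) → ι, (∏ i : Fin N, M (w i.castSucc) (w i.succ)) *
            ∑ j, M (w (Fin.last N)) j * u j := by
          refine Finset.sum_congr rfl fun w _ => ?_
          rw [Finset.mul_sum]
          refine Finset.sum_congr rfl fun j _ => ?_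
          simp only [Fin.snocEquiv, Equiv.coe_fn_mk, Fin.prod_univ_castSucc, Fin.snoc_castSucc,
            Fin.succ_last, Fin.snoc_last, Fin.succ_castSucc]
          ring
      _ ≤ ∑ w : Fin (N + 1) → ι, (∏ i : Fin N, M (w i.castSucc) (w i.succ)) *
            (Λ * u (w (Fin.last N))) :=
          Finset.sum_le_sum fun w _ => mul_le_mul_of_nonneg_left (hMu _)
            (Finset.prod_nonneg fun i _ => (hM _ _).le)
      _ = Λ * ∑ w : Fin (N + 1) → ι,
            (∏ i : Fin N, M (w i.castSucc) (w i.succ)) * u (w (Fin.last N)) := by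
          rw [Finset.mul_sum]
          exact Finset.sum_congr rfl fun w _ => by ring
      _ ≤ Λ * (Λ ^ N * ∑ i, u i) := mul_le_mul_of_nonneg_left ih hΛ
      _ = _ := by ring

/-- The probability of guessing the label `a` when `b` is the predicted label and the prediction
is trusted with confidence `1 - ε`. -/
noncomputable def guess {k : ℕ} (ε : ℝ) (a b : Fin k) : ℝ := if a = b then 1 - ε else ε / k

lemma guess_pos {k : ℕ} {ε : ℝ} (h0 : 0 < ε) (h1 : ε < 1) (a b : Fin k) : 0 < guess ε a b := by
  unfold guess
  have : 0 < (k : ℝ) := by exact_mod_cast a.pos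
  split_ifs
  · linarith
  · positivity

lemma sum_guess_le {k : ℕ} {ε : ℝ} (h0 : 0 < ε) (b : Fin k) :
    ∑ a, guess ε a b ≤ 1 := by
  have hk : 0 < (k : ℝ) := by exact_mod_cast b.pos
  have : ∀ a, guess ε a b ≤ (if a = b then 1 - ε else 0) + ε / k := by
    intro a
    unfold guess
    split_ifs
    · have : 0 ≤ ε / k := by positivity
      linarith
    · simp
  calc _ ≤ ∑ a, ((if a = b then 1 - ε else 0) + ε / k) := Finset.sum_le_sum fun a _ => this a
    _ = 1 := by
      rw [Finset.sum_add_distrib]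
      simp
      field_simp
      ring

lemma sum_prod_guess_le {k n : ℕ} {ε : ℝ} (h0 : 0 < ε) (h1 : ε < 1) (b : Fin n → Fin k) :
    ∑ a : Fin n → Fin k, ∏ i, guess ε (a i) (b i) ≤ 1 := by
  rw [← Fintype.prod_sum fun i a => guess ε a (b i)]
  exact Finset.prod_le_one
    (fun i _ => Finset.sum_nonneg fun a _ => (guess_pos h0 h1 _ _).le)
    (fun i _ => sum_guess_le h0 _)

lemma neg_log_guess_le {k : ℕ} {ε : ℝ} (h0 : 0 < ε) (h1 : ε < 1) (a b : Fin k) :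
    -Real.log (guess ε a b) ≤
      -Real.log (1 - ε) + (if a ≠ b then Real.log (k / ε) else 0) := by
  have hk : 0 < (k : ℝ) := by exact_mod_cast b.pos
  unfold guess
  by_cases h : a = b
  · simp [h]
  · simp only [h, if_false, ne_eq, not_false_eq_true, if_true]
    rw [Real.log_div h0.ne' hk.ne', Real.log_div hk.ne' h0.ne']
    have := Real.log_nonpos (by linarith : (0 : ℝ) ≤ 1 - ε) (by linarith)
    linarith

end Weights

/-! ### Entropy bounds from a generator -/

section UpperBound

variable {α : Type*} [MeasurableSpace α] {T : α → α}

lemma measurable_itinerary {ι : Type*} [MeasurableSpace ι] (hT : Measurable T) {P : α → ι}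
    (hP : Measurable P) (n : ℕ) : Measurable (itinerary T P n) :=
  measurable_pi_lambda _ fun i => hP.comp (hT.iterate i)

lemma integral_comp_iterate {μ : Measure α} (hT : MeasurePreserving T μ μ) {g : α → ℝ}
    (hg : AEStronglyMeasurable g μ) (i : ℕ) : ∫ x, g (T^[i] x) ∂μ = ∫ x, g x ∂μ := by
  have h := hT.iterate i
  conv_rhs => rw [← h.map_eq]
  rw [integral_map h.measurable.aemeasurable (by rwa [h.map_eq])]

variable {μ : Measure α} [IsProbabilityMeasure μ]

/-- The names of length `n` with respect to `P` are coded together with the names with respect to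
`ξ`: the latter by a Markov weight, the former by predicting each label as `Q` of the next `m`
`ξ`-symbols. -/
lemma partitionEntropy_itinerary_le {ι : Type*} [Fintype ι] [MeasurableSpace ι]
    [MeasurableSingletonClass ι] (hT : MeasurePreserving T μ μ) {ξ : α → ι} (hξ : Measurable ξ)
    {M : ι → ι → ℝ} {u : ι → ℝ} {Λ : ℝ} (hM : ∀ i j, 0 < M i j) (hu : ∀ i, 0 < u i) (hΛ : 0 < Λ)
    (hMu : ∀ i, ∑ j, M i j * u j ≤ Λ * u i) {k : ℕ} {P : α → Fin k} (hP : Measurable P)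
    {m : ℕ} (Q : (Fin m → ι) → Fin k) {ε : ℝ} (h0 : 0 < ε) (h1 : ε < 1) (n : ℕ) :
    partitionEntropy μ (itinerary T P n) ≤
      (Real.log (∑ i, u i) + ∑ i, |Real.log (u i)|) +
      (n + m : ℕ) * (Real.log Λ - ∫ x, Real.log (M (ξ x) (ξ (T x))) ∂μ) +
      n * ∫ x, -Real.log (guess ε (P x) (Q (itinerary T ξ m x))) ∂μ := by
  classical
  have : Nonempty α := nonempty_of_isProbabilityMeasure μ
  have : Nonempty ι := this.map ξ
  set C := ∑ i, u i with hC
  have hCpos : 0 < C := Finset.sum_pos (fun i _ => hu i) Finset.univ_nonempty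
  let Y : α → (Fin n → Fin k) × (Fin (n + m + 1) → ι) :=
    fun x => (itinerary T P n x, itinerary T ξ (n + m + 1) x)
  have hY : Measurable Y :=
    (measurable_itinerary hT.measurable hP n).prodMk (measurable_itinerary hT.measurable hξ _)
  let W : (Fin (n + m + 1) → ι) → Fin n → Fin k :=
    fun w i => Q fun j : Fin m => w ⟨i + j, by omega⟩
  let G : (Fin n → Fin k) × (Fin (n + m + 1) → ι) → ℝ := fun b =>
    Real.log C + (n + m : ℕ) * Real.log Λ
      - ∑ i : Fin (n + m), Real.log (M (b.2 i.castSucc) (b.2 i.succ))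
      - Real.log (u (b.2 (Fin.last _))) - ∑ i, Real.log (guess ε (b.1 i) (W b.2 i))
  have hexp : ∀ b, Real.exp (-G b) =
      (((∏ i : Fin (n + m), M (b.2 i.castSucc) (b.2 i.succ)) * u (b.2 (Fin.last _))) *
        ∏ i, guess ε (b.1 i) (W b.2 i)) / (Λ ^ (n + m) * C) := by
    intro b
    have e1 := Finset.prod_pos (s := Finset.univ)
      fun (i : Fin (n + m)) _ => hM (b.2 i.castSucc) (b.2 i.succ)
    have e2 := Finset.prod_pos (s := Finset.univ)
      fun (i : Fin n) _ => guess_pos h0 h1 (b.1 i) (W b.2 i)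
    have e3 := hu (b.2 (Fin.last _))
    rw [← Real.exp_log (div_pos (mul_pos (mul_pos e1 e3) e2) (mul_pos (pow_pos hΛ (n + m)) hCpos)),
      Real.log_div (by positivity) (by positivity), Real.log_mul (by positivity) (by positivity),
      Real.log_mul (by positivity) (by positivity), Real.log_mul (by positivity) (by positivity),
      Real.log_pow, Real.log_prod fun i _ => (hM _ _).ne',
      Real.log_prod fun i _ => (guess_pos h0 h1 _ _).ne']
    congr 1
    simp only [G]
    ring
  have hsum : ∑ b, Real.exp (-G b) ≤ 1 := by
    simp_rw [hexp]
    rw [← Finset.sum_div, div_le_one (mul_pos (pow_pos hΛ _) hCpos), Fintype.sum_prod_type_right]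
    refine le_trans ?_ (sum_markovWeight_le hM hΛ.le hMu (n + m))
    refine Finset.sum_le_sum fun w _ => ?_
    simp only
    rw [← Finset.mul_sum]
    refine mul_le_of_le_one_right ?_ (sum_prod_guess_le h0 h1 _)
    exact mul_nonneg (Finset.prod_nonneg fun i _ => (hM _ _).le) (hu _).le
  have key := partitionEntropy_comp_le_integral (μ := μ) hY Prod.fst G hsum
  refine key.trans ?_
  have hF1 : Measurable fun x => (ξ x, ξ (T x)) := hξ.prodMk (hξ.comp hT.measurable)
  have hF2 : Measurable fun x => (P x, itinerary T ξ m x) :=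
    hP.prodMk (measurable_itinerary hT.measurable hξ m)
  have hi1 : Integrable (fun x => Real.log (M (ξ x) (ξ (T x)))) μ :=
    integrable_comp_of_finite hF1 fun p => Real.log (M p.1 p.2)
  have hi2 : Integrable (fun x => -Real.log (guess ε (P x) (Q (itinerary T ξ m x)))) μ :=
    integrable_comp_of_finite hF2 fun p => -Real.log (guess ε p.1 (Q p.2))
  have hj1 : ∀ i ∈ Finset.range (n + m),
      Integrable (fun x => Real.log (M (ξ (T^[i] x)) (ξ (T (T^[i] x))))) μ :=
    fun i _ => (hT.iterate i).integrable_comp_of_integrable hi1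
  have hj2 : ∀ i ∈ Finset.range n, Integrable
      (fun x => -Real.log (guess ε (P (T^[i] x)) (Q (itinerary T ξ m (T^[i] x))))) μ :=
    fun i _ => (hT.iterate i).integrable_comp_of_integrable hi2
  have hG : ∀ x, G (Y x) ≤ (Real.log C + ∑ i, |Real.log (u i)|) + (n + m : ℕ) * Real.log Λ
      - ∑ i ∈ Finset.range (n + m), Real.log (M (ξ (T^[i] x)) (ξ (T (T^[i] x))))
      + ∑ i ∈ Finset.range n,
        -Real.log (guess ε (P (T^[i] x)) (Q (itinerary T ξ m (T^[i] x)))) := by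
    intro x
    have e1 : ∑ i : Fin (n + m), Real.log (M ((Y x).2 i.castSucc) ((Y x).2 i.succ)) =
        ∑ i ∈ Finset.range (n + m), Real.log (M (ξ (T^[i] x)) (ξ (T (T^[i] x)))) := by
      rw [Finset.sum_range]
      refine Finset.sum_congr rfl fun i _ => ?_
      simp [Y, itinerary, ← Function.iterate_succ_apply' T]
    have e2 : ∑ i, Real.log (guess ε ((Y x).1 i) (W (Y x).2 i)) =
        ∑ i ∈ Finset.range n,
          Real.log (guess ε (P (T^[i] x)) (Q (itinerary T ξ m (T^[i] x)))) := by
      rw [Finset.sum_range]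
      refine Finset.sum_congr rfl fun i _ => ?_
      have e : (fun j : Fin m => (Y x).2 ⟨i + j, by omega⟩) = itinerary T ξ m (T^[i] x) := by
        funext j
        simp [Y, itinerary, ← Function.iterate_add_apply, add_comm]
      simp only [W, e]
      rfl
    have e3 : -Real.log (u ((Y x).2 (Fin.last _))) ≤ ∑ i, |Real.log (u i)| :=
      (neg_le_abs _).trans (Finset.single_le_sum (f := fun i => |Real.log (u i)|)
        (fun i _ => abs_nonneg _) (Finset.mem_univ _))
    simp only [G, Finset.sum_neg_distrib]
    rw [e1, e2]
    linarith
  have hs1 : Integrable (fun x => ∑ i ∈ Finset.range (n + m),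
      Real.log (M (ξ (T^[i] x)) (ξ (T (T^[i] x))))) μ :=
    integrable_finsetSum _ hj1
  have hs2 : Integrable (fun x => ∑ i ∈ Finset.range n,
      -Real.log (guess ε (P (T^[i] x)) (Q (itinerary T ξ m (T^[i] x))))) μ :=
    integrable_finsetSum _ hj2
  refine (integral_mono (integrable_comp_of_finite hY G)
    (((integrable_const _).sub hs1).add hs2) hG).trans (le_of_eq ?_)
  rw [integral_add' ((integrable_const _).sub hs1) hs2, integral_sub' (integrable_const _) hs1,
    integral_finsetSum _ hj1, integral_finsetSum _ hj2]
  simp_rw [integral_comp_iterate hT hi1.aestronglyMeasurable,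
    integral_comp_iterate hT hi2.aestronglyMeasurable]
  simp only [integral_const, probReal_univ, one_smul, Finset.sum_const, Finset.card_range,
    nsmul_eq_mul]
  ring

/-- An upper bound for the Kolmogorov–Sinai entropy in the presence of a generator `ξ`, i.e. a
finite partition whose names approximate every finite measurable partition. -/
theorem metricEntropy_le_of_generator {ι : Type*} [Fintype ι] [MeasurableSpace ι]
    [MeasurableSingletonClass ι] (hT : MeasurePreserving T μ μ) {ξ : α → ι} (hξ : Measurable ξ)
    (hgen : ∀ (k : ℕ) (P : α → Fin k), Measurable P → ∀ δ > 0, ∃ (m : ℕ)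
      (Q : (Fin m → ι) → Fin k), μ.real {x | P x ≠ Q (itinerary T ξ m x)} ≤ δ)
    {M : ι → ι → ℝ} {u : ι → ℝ} {Λ : ℝ} (hM : ∀ i j, 0 < M i j) (hu : ∀ i, 0 < u i) (hΛ : 0 < Λ)
    (hMu : ∀ i, ∑ j, M i j * u j ≤ Λ * u i) :
    metricEntropy μ T ≤
      ENNReal.ofReal (Real.log Λ - ∫ x, Real.log (M (ξ x) (ξ (T x))) ∂μ) := by
  have : Nonempty α := nonempty_of_isProbabilityMeasure μ
  refine iSup_le fun k => iSup_le fun P => iSup_le fun hP => ?_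
  set b := Real.log Λ - ∫ x, Real.log (M (ξ x) (ξ (T x))) ∂μ with hb
  have hk : 1 ≤ (k : ℝ) := by exact_mod_cast (P this.some).pos
  -- Each prediction error costs `log (k / ε)`; `δ` makes the mean cost small for given `ε`.
  have main : ∀ ε : ℝ, 0 < ε → ε < 1 →
      entropyOfPartition μ T P ≤ ENNReal.ofReal (b + (-Real.log (1 - ε) + ε)) := by
    intro ε h0 h1
    have hlog : 0 ≤ Real.log (k / ε) :=
      Real.log_nonneg ((one_le_div h0).2 (by linarith))
    obtain ⟨m, Q, hQ⟩ := hgen k P hP (ε / (Real.log (k / ε) + 1)) (by positivity)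
    have hF2 : Measurable fun x => (P x, itinerary T ξ m x) :=
      hP.prodMk (measurable_itinerary hT.measurable hξ m)
    have hset : MeasurableSet {x | P x ≠ Q (itinerary T ξ m x)} :=
      hF2 (Set.toFinite {p : Fin k × (Fin m → ι) | p.1 ≠ Q p.2}).measurableSet
    have hκ : ∫ x, -Real.log (guess ε (P x) (Q (itinerary T ξ m x))) ∂μ ≤
        -Real.log (1 - ε) + ε := by
      have hind : Integrable ({x | P x ≠ Q (itinerary T ξ m x)}.indicator
          fun _ => Real.log (k / ε)) μ := (integrable_const _).indicator hset
      refine (integral_mono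
        (integrable_comp_of_finite hF2 fun p => -Real.log (guess ε p.1 (Q p.2)))
        ((integrable_const (-Real.log (1 - ε))).add hind) fun x => ?_).trans ?_
      · simpa [Set.indicator_apply] using neg_log_guess_le h0 h1 (P x) (Q (itinerary T ξ m x))
      · rw [integral_add' (integrable_const _) hind, integral_indicator_const _ hset]
        simp only [integral_const, probReal_univ, smul_eq_mul, one_mul]
        gcongr
        refine (mul_le_mul_of_nonneg_right hQ hlog).trans ?_
        rw [div_mul_eq_mul_div, div_le_iff₀ (by positivity)]
        nlinarith
    set c := (Real.log (∑ i, u i) + ∑ i, |Real.log (u i)|) + m * b with hc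
    have hbound : ∀ n : ℕ, 0 < n → partitionEntropy μ (itinerary T P n) / n ≤
        c / n + (b + (-Real.log (1 - ε) + ε)) := by
      intro n hn
      have hn' : (0 : ℝ) < n := by exact_mod_cast hn
      have := partitionEntropy_itinerary_le hT hξ hM hu hΛ hMu hP Q h0 h1 n
      rw [div_le_iff₀ hn', add_mul, div_mul_cancel₀ _ hn'.ne']
      refine this.trans ?_
      have h2 := mul_le_mul_of_nonneg_left hκ hn'.le
      rw [← hb, hc]
      push_cast
      linarith
    have hlim : Tendsto (fun n : ℕ => ENNReal.ofReal (c / n + (b + (-Real.log (1 - ε) + ε))))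
        atTop (𝓝 (ENNReal.ofReal (0 + (b + (-Real.log (1 - ε) + ε))))) :=
      ENNReal.tendsto_ofReal ((tendsto_const_div_atTop_nhds_zero_nat c).add_const _)
    rw [zero_add] at hlim
    rw [← hlim.limsup_eq]
    refine limsup_le_limsup ?_
    filter_upwards [eventually_gt_atTop 0] with n hn
    exact ENNReal.ofReal_le_ofReal (hbound n hn)
  have hcont : ContinuousAt (fun ε : ℝ => ENNReal.ofReal (b + (-Real.log (1 - ε) + ε))) 0 := by
    refine ENNReal.continuous_ofReal.continuousAt.comp ?_
    have : (1 : ℝ) - 0 ≠ 0 := by norm_num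
    fun_prop (disch := assumption)
  have hlim : Tendsto (fun ε : ℝ => ENNReal.ofReal (b + (-Real.log (1 - ε) + ε))) (𝓝[>] 0)
      (𝓝 (ENNReal.ofReal b)) := by
    have := hcont.tendsto.mono_left (nhdsWithin_le_nhds (s := Set.Ioi 0))
    simpa using this
  refine ge_of_tendsto hlim ?_
  filter_upwards [Ioo_mem_nhdsGT (zero_lt_one' ℝ)] with ε hε
  exact main ε hε.1 hε.2

end UpperBound

/-! ### One-cylinders generate -/

section Generator

variable {d : ℕ} {A : Matrix (Fin d) (Fin d) ℕ}

lemma shift_iterate_apply (x : SFT A) (i n : ℕ) : ((shift A)^[i] x).1 n = x.1 (n + i) := by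
  induction i generalizing x with
  | zero => rfl
  | succ i ih =>
    rw [Function.iterate_succ_apply, ih]
    change x.1 (n + i + 1) = _
    rw [add_assoc]

lemma measurable_coord (n : ℕ) : Measurable fun x : SFT A => x.1 n :=
  (measurable_pi_apply n).comp measurable_subtype_coe

lemma measurable_shift : Measurable (shift A) :=
  Measurable.subtype_mk (measurable_pi_lambda _ fun n => measurable_coord (n + 1))

/-- The partition into the cylinders of length one generates: cylinder sets are dense among the
measurable sets, so finite partitions are approximated by partitions into unions of cylinders. -/
lemma exists_cylinder_approx {μ : Measure (SFT A)} [IsProbabilityMeasure μ]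
    (k : ℕ) (P : SFT A → Fin k) (hP : Measurable P) (δ : ℝ) (hδ : 0 < δ) :
    ∃ (m : ℕ) (Q : (Fin m → Fin d) → Fin k),
      μ.real {x | P x ≠ Q (itinerary (shift A) (fun x => x.1 0) m x)} ≤ δ := by
  classical
  obtain ⟨x₀⟩ : Nonempty (SFT A) := nonempty_of_isProbabilityMeasure μ
  have hk : 0 < (k : ℝ) := by exact_mod_cast (P x₀).pos
  have hcoe : Measurable (Subtype.val : SFT A → ℕ → Fin d) := measurable_subtype_coe
  have : IsProbabilityMeasure (μ.map Subtype.val) :=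
    Measure.isProbabilityMeasure_map hcoe.aemeasurable
  have hdense := Measure.MeasureDense.of_generateFrom_isSetAlgebra_finite (μ.map Subtype.val)
    (isSetAlgebra_measurableCylinders (α := fun _ : ℕ => Fin d))
    generateFrom_measurableCylinders.symm
  have happrox : ∀ j : Fin k, ∃ (a : ℕ) (S : Set (∀ _ : Finset.Iic a, Fin d)),
      μ (symmDiff (P ⁻¹' {j}) (Subtype.val ⁻¹' cylinder (Finset.Iic a) S)) ≤
        ENNReal.ofReal (δ / k) := by
    intro j
    obtain ⟨B, hB, hBj⟩ := hP (measurableSet_singleton j)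
    obtain ⟨C, hC, hBC⟩ := hdense.approx B hB (measure_ne_top _ _) (δ / k) (by positivity)
    have hCm := hdense.measurable C hC
    rw [measurableCylinders_nat] at hC
    simp only [Set.mem_iUnion, Set.mem_singleton_iff] at hC
    obtain ⟨a, S, -, rfl⟩ := hC
    refine ⟨a, S, ?_⟩
    rw [Measure.map_apply hcoe (hB.symmDiff hCm)] at hBC
    rw [← hBj]
    exact hBC.le
  choose a S hS using happrox
  -- All the approximating cylinders are read off from the first `m` symbols.
  let m := ∑ j, (a j + 1)
  have ham : ∀ j, a j < m := fun j =>
    Nat.lt_of_succ_le (Finset.single_le_sum (f := fun j => a j + 1) (fun _ _ => by omega)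
      (Finset.mem_univ j))
  let R : (Fin m → Fin d) → Fin k → Prop := fun w j =>
    (fun i : Finset.Iic (a j) => w ⟨i.1, (Finset.mem_Iic.1 i.2).trans_lt (ham j)⟩) ∈ S j
  let Q : (Fin m → Fin d) → Fin k := fun w => if h : ∃ j, R w j then h.choose else P x₀
  refine ⟨m, Q, ?_⟩
  have hR : ∀ x j, R (itinerary (shift A) (fun x => x.1 0) m x) j ↔
      x ∈ Subtype.val ⁻¹' cylinder (Finset.Iic (a j)) (S j) := by
    intro x j
    simp only [R, itinerary, shift_iterate_apply, zero_add, Set.mem_preimage, mem_cylinder]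
    rfl
  have hsub : {x | P x ≠ Q (itinerary (shift A) (fun x => x.1 0) m x)} ⊆
      ⋃ j, symmDiff (P ⁻¹' {j}) (Subtype.val ⁻¹' cylinder (Finset.Iic (a j)) (S j)) := by
    intro x hx
    by_contra hcon
    have hiff : ∀ j, R (itinerary (shift A) (fun x => x.1 0) m x) j ↔ P x = j := by
      intro j
      rw [hR]
      have : x ∉ symmDiff (P ⁻¹' {j}) (Subtype.val ⁻¹' cylinder (Finset.Iic (a j)) (S j)) :=
        fun h => hcon (Set.mem_iUnion.2 ⟨j, h⟩)
      rw [Set.mem_symmDiff] at this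
      simp only [Set.mem_preimage, Set.mem_singleton_iff] at this ⊢
      tauto
    have hex : ∃ j, R (itinerary (shift A) (fun x => x.1 0) m x) j := ⟨P x, (hiff _).2 rfl⟩
    refine hx ?_
    simp only [Q, dif_pos hex]
    exact (hiff _).1 hex.choose_spec
  have hle : μ {x | P x ≠ Q (itinerary (shift A) (fun x => x.1 0) m x)} ≤ ENNReal.ofReal δ :=
    calc _ ≤ ∑ j, μ (symmDiff (P ⁻¹' {j})
            (Subtype.val ⁻¹' cylinder (Finset.Iic (a j)) (S j))) :=
          (measure_mono hsub).trans (measure_iUnion_fintype_le _ _)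
      _ ≤ ∑ _j : Fin k, ENNReal.ofReal (δ / k) := Finset.sum_le_sum fun j _ => hS j
      _ = ENNReal.ofReal δ := by
          rw [Finset.sum_const, Finset.card_univ, Fintype.card_fin, nsmul_eq_mul,
            ← ENNReal.ofReal_natCast, ← ENNReal.ofReal_mul hk.le, mul_div_cancel₀ _ hk.ne']
  exact ENNReal.toReal_le_of_le_ofReal hδ.le hle

end Generator

/-! ### Convex combinations of invariant measures -/

section RotationVectors

variable {d m : ℕ} {A : Matrix (Fin d) (Fin d) ℕ}

lemma convexComb_mem_invMeasures {μ ν : Measure (SFT A)} (hμ : μ ∈ invMeasures A)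
    (hν : ν ∈ invMeasures A) {a b : ℝ} (ha : 0 ≤ a) (hb : 0 ≤ b) (hab : a + b = 1) :
    ENNReal.ofReal a • μ + ENNReal.ofReal b • ν ∈ invMeasures A := by
  obtain ⟨_, hμi⟩ := hμ
  obtain ⟨_, hνi⟩ := hν
  refine ⟨⟨?_⟩, measurable_shift, ?_⟩
  · simp [← ENNReal.ofReal_add ha hb, hab]
  · rw [Measure.map_add _ _ measurable_shift, Measure.map_smul, Measure.map_smul,
      hμi.map_eq, hνi.map_eq]

lemma rv_convexComb {Φ : SFT A → EuclideanSpace ℝ (Fin m)} {μ ν : Measure (SFT A)}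
    (hμ : ∀ i, Integrable (fun x => Φ x i) μ) (hν : ∀ i, Integrable (fun x => Φ x i) ν)
    {a b : ℝ} (ha : 0 ≤ a) (hb : 0 ≤ b) :
    rv Φ (ENNReal.ofReal a • μ + ENNReal.ofReal b • ν) = a • rv Φ μ + b • rv Φ ν := by
  ext i
  simp only [rv, PiLp.add_apply, PiLp.smul_apply, smul_eq_mul]
  rw [integral_add_measure ((hμ i).smul_measure ENNReal.ofReal_ne_top)
    ((hν i).smul_measure ENNReal.ofReal_ne_top), integral_smul_measure, integral_smul_measure,
    ENNReal.toReal_ofReal ha, ENNReal.toReal_ofReal hb, smul_eq_mul, smul_eq_mul]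

end RotationVectors

/-! ### The potential as a function of two symbols -/

section PairValue

/-- The pairs of symbols to which the potential assigns the value `w₁`. -/
def pairs₁ : Finset (Fin 6 × Fin 6) := {(0, 0), (0, 1), (1, 0), (4, 4)}

/-- The pairs of symbols to which the potential assigns the value `w₂`. -/
def pairs₂ : Finset (Fin 6 × Fin 6) := {(3, 3), (3, 4), (4, 3), (1, 1)}

/-- The value of the potential on sequences that start with a given pair of symbols. -/
noncomputable def pairValue (p : Fin 6 × Fin 6) : EuclideanSpace ℝ (Fin 2) :=
  if p ∈ pairs₁ then w₁ else if p ∈ pairs₂ then w₂ else w₃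

/-- The first two symbols of a sequence. -/
def firstPair (x : SFT A) : Fin 6 × Fin 6 := (x.1 0, x.1 1)

lemma measurable_firstPair : Measurable firstPair :=
  (measurable_coord 0).prodMk (measurable_coord 1)

lemma Φ_eq (x : SFT A) : Φ x = pairValue (firstPair x) := by
  have h : ∀ a b : Fin 6, x ∈ cyl A ![a, b] ↔ firstPair x = (a, b) := by
    intro a b
    simp [cyl, firstPair, Fin.forall_fin_two, Prod.ext_iff]
  simp only [Φ, pairValue, pairs₁, pairs₂, Set.mem_union, h, Finset.mem_insert,
    Finset.mem_singleton, or_assoc]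

lemma integrable_Φ {μ : Measure (SFT A)} [IsProbabilityMeasure μ] (i : Fin 2) :
    Integrable (fun x => Φ x i) μ := by
  simp only [Φ_eq]
  exact integrable_comp_of_finite measurable_firstPair fun p => pairValue p i

end PairValue

/-! ### The rotation set and its lower side -/

section RotationSet

lemma pairValue_mem (p : Fin 6 × Fin 6) :
    pairValue p ∈ ({w₁, w₂, w₃} : Set (EuclideanSpace ℝ (Fin 2))) := by
  unfold pairValue
  split_ifs <;> simp

lemma rv_Φ_eq_sum {μ : Measure (SFT A)} [IsProbabilityMeasure μ] :
    rv Φ μ = ∑ p, μ.real (firstPair ⁻¹' {p}) • pairValue p := by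
  ext i
  simp only [rv, Φ_eq]
  rw [integral_comp_eq_sum measurable_firstPair fun p => pairValue p i]
  simp

lemma rv_Φ_mem_triangle {μ : Measure (SFT A)} [IsProbabilityMeasure μ] :
    rv Φ μ ∈ triangle := by
  rw [rv_Φ_eq_sum]
  refine (convex_convexHull ℝ _).sum_mem (fun _ _ => measureReal_nonneg) ?_
    fun p _ => subset_convexHull ℝ _ (pairValue_mem p)
  rw [sum_measureReal_preimage_singleton _
    fun p _ => measurable_firstPair (measurableSet_singleton p)]
  simp

lemma measurable_pairValue_firstPair (i : Fin 2) :
    Measurable fun x => pairValue (firstPair x) i :=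
  (measurable_of_finite fun p => pairValue p i).comp measurable_firstPair

/-- The fixed point `aaa…` of the shift. -/
def constSeq (a : Fin 6) (ha : A a a = 1) : SFT A := ⟨fun _ => a, fun _ => ha⟩

lemma pairValue_mem_Rot (a : Fin 6) (ha : A a a = 1) : pairValue (a, a) ∈ Rot Φ := by
  refine ⟨Measure.dirac (constSeq a ha), ⟨inferInstance, measurable_shift, ?_⟩, ?_⟩
  · rw [Measure.map_dirac' measurable_shift]
    rfl
  · ext i
    simp only [rv, Φ_eq]
    exact integral_dirac' (fun x => pairValue (firstPair x) i) (constSeq a ha)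
      (measurable_pairValue_firstPair i).stronglyMeasurable

lemma convex_Rot_Φ : Convex ℝ (Rot Φ) := by
  rintro _ ⟨μ, hμ, rfl⟩ _ ⟨ν, hν, rfl⟩ a b ha hb hab
  have := hμ.1
  have := hν.1
  exact ⟨_, convexComb_mem_invMeasures hμ hν ha hb hab,
    rv_convexComb (fun i => integrable_Φ i) (fun i => integrable_Φ i) ha hb⟩

lemma Rot_Φ_eq_triangle : Rot Φ = triangle := by
  refine Set.Subset.antisymm ?_ (convexHull_min ?_ convex_Rot_Φ)
  · rintro _ ⟨μ, hμ, rfl⟩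
    have := hμ.1
    exact rv_Φ_mem_triangle
  · rintro w (rfl | rfl | rfl)
    · simpa [pairValue, pairs₁] using pairValue_mem_Rot 0 (by decide)
    · simpa [pairValue, pairs₁, pairs₂] using pairValue_mem_Rot 3 (by decide)
    · simpa [pairValue, pairs₁, pairs₂] using pairValue_mem_Rot 2 (by decide)

/-- The parametrisation `t ↦ (t, 0)` of the line through the lower side of the triangle. -/
noncomputable def baseLine : ℝ →ₗᵢ[ℝ] EuclideanSpace ℝ (Fin 2) :=
  LinearIsometry.toSpanSingleton ℝ _ (v := w₂) (by simp [w₂, EuclideanSpace.norm_eq])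

lemma baseLine_apply (t : ℝ) : baseLine t = !₂[t, 0] := by
  ext i
  fin_cases i <;> simp [baseLine, w₂]

lemma eq_baseLine {w : EuclideanSpace ℝ (Fin 2)} (h : w 1 = 0) : w = baseLine (w 0) := by
  rw [baseLine_apply]
  ext i
  fin_cases i <;> simp [h]

lemma segment_eq_image_baseLine {a b : ℝ} (h : a ≤ b) :
    segment ℝ (!₂[a, 0] : EuclideanSpace ℝ (Fin 2)) !₂[b, 0] = baseLine '' Set.Icc a b := by
  rw [← segment_eq_Icc h, ← baseLine_apply, ← baseLine_apply]
  exact (image_segment ℝ baseLine.toLinearMap.toAffineMap a b).symm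

lemma F_eq_image : F = baseLine '' Set.Icc 0 1 := segment_eq_image_baseLine zero_le_one

lemma segment_v_eq_image : segment ℝ v₁ v₂ = baseLine '' Set.Icc (1 / 4) (3 / 4) :=
  segment_eq_image_baseLine (by norm_num)

lemma triangle_subset : triangle ⊆ {u | 0 ≤ u 1 ∧ u 1 ≤ 2 * u 0 ∧ u 1 ≤ 2 - 2 * u 0} := by
  refine convexHull_min ?_ ?_
  · rintro w (rfl | rfl | rfl) <;> (simp [w₁, w₂, w₃]; try norm_num)
  · rintro u ⟨h1, h2, h3⟩ v ⟨k1, k2, k3⟩ a b ha hb hab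
    simp only [Set.mem_ofPred_eq, PiLp.add_apply, PiLp.smul_apply, smul_eq_mul]
    refine ⟨by positivity, ?_, ?_⟩
    · nlinarith
    · nlinarith [mul_le_mul_of_nonneg_left h3 ha, mul_le_mul_of_nonneg_left k3 hb]

lemma isFace_triangle_F : IsFace triangle F := by
  refine ⟨⟨w₁, left_mem_segment ℝ _ _⟩, !₂[0, -1], 0, ?_, ?_, ?_⟩
  · intro h
    simpa using congrArg (fun v : EuclideanSpace ℝ (Fin 2) => v 1) h
  · intro u hu
    simpa [PiLp.inner_apply] using (triangle_subset hu).1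
  · ext u
    constructor
    · intro hu
      refine ⟨segment_subset_convexHull (by simp) (by simp) hu, ?_⟩
      rw [F_eq_image] at hu
      obtain ⟨t, -, rfl⟩ := hu
      simp [PiLp.inner_apply, baseLine_apply]
    · rintro ⟨hu, h0⟩
      have h1 : u 1 = 0 := by simpa [PiLp.inner_apply] using h0
      obtain ⟨-, h2, h3⟩ := triangle_subset hu
      rw [F_eq_image]
      exact ⟨u 0, ⟨by linarith, by linarith⟩, (eq_baseLine h1).symm⟩

lemma baseLine_Ioo_subset_intrinsicInterior :
    baseLine '' Set.Ioo 0 1 ⊆ intrinsicInterior ℝ F := by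
  have h := baseLine.toAffineIsometry.intrinsicInterior_image (Set.Icc (0 : ℝ) 1)
  rw [LinearIsometry.coe_toAffineIsometry, ← F_eq_image] at h
  rw [h, ← interior_Icc]
  exact Set.image_mono interior_subset_intrinsicInterior

end RotationSet

/-! ### Entropy over the lower side of the triangle -/

section UpperBound

/-- The transfer weights: `1` and `1 + s` on pairs with potential `w₁` and `w₂`, and a penalty `η`
on all other pairs. -/
noncomputable def weight (s η : ℝ) (i j : Fin 6) : ℝ :=
  if (i, j) ∈ pairs₁ then 1 else if (i, j) ∈ pairs₂ then 1 + s else η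

/-- On each of `{0, 1}` and `{3, 4}`, a right eigenvector of the corresponding block of `weight s η`
up to first order in `s`; the eigenvalues are `2 + s / 2` and `2 + 3 * s / 2` to that order. -/
noncomputable def weightVec (s : ℝ) : Fin 6 → ℝ := ![1, 1 + s / 2, 1, 1, 1 - s / 2, 1]

lemma sum_weight_mul_weightVec_le {s η L : ℝ} (hs : |s| ≤ 1 / 2) (hη : 0 < η)
    (h1 : 2 + s / 2 + s ^ 2 ≤ L) (h2 : 2 + 3 * s / 2 + s ^ 2 ≤ L) (i : Fin 6) :
    ∑ j, weight s η i j * weightVec s j ≤ (L + 12 * η) * weightVec s i := by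
  obtain ⟨hs1, hs2⟩ := abs_le.1 hs
  have hp : 0 ≤ η * (1 / 2 - s) := mul_nonneg hη.le (by linarith)
  have hm : 0 ≤ η * (1 / 2 + s) := mul_nonneg hη.le (by linarith)
  have h1' := mul_le_mul_of_nonneg_right h1 (by linarith : 0 ≤ 1 + s / 2)
  have h2' := mul_le_mul_of_nonneg_right h2 (by linarith : 0 ≤ 1 - s / 2)
  have hq : 0 ≤ s ^ 2 * (1 / 2 - s) := mul_nonneg (sq_nonneg s) (by linarith)
  have hr : 0 ≤ s ^ 2 * (1 / 2 + s) := mul_nonneg (sq_nonneg s) (by linarith)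
  rw [Fin.sum_univ_six]
  fin_cases i <;> simp [weight, weightVec, pairs₁, pairs₂] <;> nlinarith

/-- Invariant measures over the lower side of the triangle do not charge pairs with potential
`w₃`. -/
lemma ae_firstPair_mem {μ : Measure (SFT A)} [IsProbabilityMeasure μ] (h : rv Φ μ 1 = 0) :
    ∀ᵐ x ∂μ, firstPair x ∈ pairs₁ ∨ firstPair x ∈ pairs₂ := by
  -- The second coordinate of the potential is the indicator of the pairs with potential `w₃`.
  have hval : ∀ p, pairValue p 1 = if p ∈ pairs₁ ∨ p ∈ pairs₂ then 0 else 1 := by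
    intro p
    by_cases h1 : p ∈ pairs₁ <;> by_cases h2 : p ∈ pairs₂ <;>
      simp [pairValue, h1, h2, w₁, w₂, w₃]
  have hnn : 0 ≤ᵐ[μ] fun x => Φ x 1 := by
    refine Eventually.of_forall fun x => ?_
    simp only [Φ_eq, hval, Pi.zero_apply]
    split_ifs <;> simp
  have h0 : ∫ x, Φ x 1 ∂μ = 0 := h
  rw [integral_eq_zero_iff_of_nonneg_ae hnn (integrable_Φ 1)] at h0
  filter_upwards [h0] with x hx
  simp only [Φ_eq, hval, Pi.zero_apply] at hx
  by_contra hcon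
  simp [hcon] at hx

/-- The entropy bound for the transfer weights `weight s η`, in the limit `η → 0`. The parameter
`s` is the tilt in the direction of the first coordinate of the rotation vector. -/
lemma metricEntropy_le {μ : Measure (SFT A)} (hμ : μ ∈ invMeasures A) (h : rv Φ μ 1 = 0)
    {s L : ℝ} (hs : |s| ≤ 1 / 2) (h1 : 2 + s / 2 + s ^ 2 ≤ L) (h2 : 2 + 3 * s / 2 + s ^ 2 ≤ L) :
    metricEntropy μ (shift A) ≤
      ENNReal.ofReal (Real.log L - rv Φ μ 0 * Real.log (1 + s)) := by
  obtain ⟨_, hinv⟩ := hμ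
  obtain ⟨hs1, hs2⟩ := abs_le.1 hs
  have hL : 0 < L := by nlinarith [sq_nonneg s]
  have main : ∀ η > 0, metricEntropy μ (shift A) ≤
      ENNReal.ofReal (Real.log (L + 12 * η) - rv Φ μ 0 * Real.log (1 + s)) := by
    intro η hη
    have hM : ∀ i j, 0 < weight s η i j := by
      intro i j
      unfold weight
      split_ifs
      · exact one_pos
      · linarith
      · exact hη
    have hu : ∀ i, 0 < weightVec s i := by
      intro i
      fin_cases i <;> simp [weightVec] <;> linarith
    have key := metricEntropy_le_of_generator hinv (measurable_coord 0) exists_cylinder_approx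
      hM hu (by positivity) (sum_weight_mul_weightVec_le hs hη h1 h2)
    have hint : ∫ x : SFT A, Real.log (weight s η (x.1 0) ((shift A x).1 0)) ∂μ =
        rv Φ μ 0 * Real.log (1 + s) := by
      have : rv Φ μ 0 * Real.log (1 + s) = ∫ x, Φ x 0 * Real.log (1 + s) ∂μ :=
        (integral_mul_const _ _).symm
      rw [this]
      refine integral_congr_ae ?_
      filter_upwards [ae_firstPair_mem h] with x hx
      change Real.log (if firstPair x ∈ pairs₁ then 1 else
        if firstPair x ∈ pairs₂ then 1 + s else η) = _
      rw [Φ_eq, pairValue]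
      by_cases hx1 : firstPair x ∈ pairs₁
      · simp [hx1, w₁]
      · simp [hx1, hx.resolve_left hx1, w₂]
    rwa [hint] at key
  have hcont : ContinuousAt (fun η : ℝ =>
      ENNReal.ofReal (Real.log (L + 12 * η) - rv Φ μ 0 * Real.log (1 + s))) 0 := by
    refine ENNReal.continuous_ofReal.continuousAt.comp ?_
    have : L + 12 * 0 ≠ 0 := by simpa using hL.ne'
    fun_prop (disch := assumption)
  have hlim := hcont.tendsto.mono_left (nhdsWithin_le_nhds (s := Set.Ioi 0))
  rw [mul_zero, add_zero] at hlim
  exact ge_of_tendsto hlim (eventually_mem_nhdsWithin.mono main)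

lemma localizedEntropy_le {t s L : ℝ} (hs : |s| ≤ 1 / 2) (h1 : 2 + s / 2 + s ^ 2 ≤ L)
    (h2 : 2 + 3 * s / 2 + s ^ 2 ≤ L) :
    localizedEntropy Φ (baseLine t) ≤ ENNReal.ofReal (Real.log L - t * Real.log (1 + s)) := by
  refine iSup₂_le fun μ hμ => ?_
  obtain ⟨hμ, hrv⟩ := hμ
  have h := metricEntropy_le hμ (by rw [hrv, baseLine_apply]; rfl) hs h1 h2
  rwa [hrv, show baseLine t 0 = t by rw [baseLine_apply]; rfl] at h

lemma localizedEntropy_le_log_two (t : ℝ) :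
    localizedEntropy Φ (baseLine t) ≤ ENNReal.ofReal (Real.log 2) := by
  have := localizedEntropy_le (t := t) (s := 0) (L := 2) (by norm_num) (by norm_num) (by norm_num)
  simpa using this

lemma localizedEntropy_lt_log_two {t : ℝ} (h0 : 0 ≤ t) (h1 : t ≤ 1)
    (ht : t < 1 / 4 ∨ 3 / 4 < t) :
    localizedEntropy Φ (baseLine t) < ENNReal.ofReal (Real.log 2) := by
  -- It suffices to find a tilt `s` for which the bound is better than at `s = 0`. To first order
  -- in `s`, the bound is `log 2 + (c - t) s`, with `c = 1 / 4` for `s < 0` and `c = 3 / 4` for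
  -- `s > 0`.
  suffices ∃ s L : ℝ, |s| ≤ 1 / 2 ∧ 2 + s / 2 + s ^ 2 ≤ L ∧ 2 + 3 * s / 2 + s ^ 2 ≤ L ∧
      L / 2 - 1 < t * (1 - (1 + s)⁻¹) by
    obtain ⟨s, L, hs, hL1, hL2, hlt⟩ := this
    refine (localizedEntropy_le hs hL1 hL2).trans_lt ?_
    rw [ENNReal.ofReal_lt_ofReal_iff (Real.log_pos one_lt_two)]
    obtain ⟨hs1, hs2⟩ := abs_le.1 hs
    have hL : 0 < L := by nlinarith [sq_nonneg s]
    have e1 := Real.log_le_sub_one_of_pos (half_pos hL)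
    rw [Real.log_div hL.ne' two_ne_zero] at e1
    have e2 := mul_le_mul_of_nonneg_left
      (Real.one_sub_inv_le_log_of_pos (by linarith : 0 < 1 + s)) h0
    linarith
  have hinv : ∀ s : ℝ, |s| ≤ 1 / 2 → t * (1 - (1 + s)⁻¹) = t * s / (1 + s) := by
    intro s hs
    have : 1 + s ≠ 0 := by linarith [(abs_le.1 hs).1]
    field_simp
    ring
  rcases ht with ht | ht
  · have hs : |(t - 1 / 4) / 2| ≤ 1 / 2 := by rw [abs_le]; constructor <;> linarith
    refine ⟨(t - 1 / 4) / 2, _, hs, le_rfl, by linarith, ?_⟩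
    rw [hinv _ hs, lt_div_iff₀ (by linarith)]
    nlinarith [mul_pos (sub_pos.2 ht) (sub_pos.2 ht)]
  · have hs : |(t - 3 / 4) / 2| ≤ 1 / 2 := by rw [abs_le]; constructor <;> linarith
    refine ⟨(t - 3 / 4) / 2, _, hs, by linarith, le_rfl, ?_⟩
    rw [hinv _ hs, lt_div_iff₀ (by linarith)]
    nlinarith [mul_pos (sub_pos.2 ht) (sub_pos.2 ht)]

end UpperBound

/-! ### Bernoulli measures -/

section Bernoulli

/-- The distribution of a sequence of independent fair coin tosses. -/
noncomputable def coin : Measure (ℕ → Bool) :=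
  Measure.infinitePi fun _ => (PMF.uniformOfFintype Bool).toMeasure

instance : IsProbabilityMeasure coin := by unfold coin; infer_instance

lemma coin_pi (s : Finset ℕ) (t : ℕ → Set Bool) :
    coin (Set.pi s t) = ∏ i ∈ s, (PMF.uniformOfFintype Bool).toMeasure (t i) :=
  Measure.infinitePi_pi _ fun _ _ => MeasurableSet.of_discrete

lemma measurePreserving_coin_shift :
    MeasurePreserving (fun (y : ℕ → Bool) n => y (n + 1)) coin coin := by
  have hm : Measurable fun (y : ℕ → Bool) n => y (n + 1) :=
    measurable_pi_lambda _ fun n => measurable_pi_apply (n + 1)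
  refine ⟨hm, Measure.eq_infinitePi _ fun s t ht => ?_⟩
  rw [Measure.map_apply hm (MeasurableSet.pi s.countable_toSet fun i _ => ht i)]
  have : (fun (y : ℕ → Bool) n => y (n + 1)) ⁻¹' (Set.pi s t) =
      Set.pi (s.image Nat.succ : Finset ℕ) fun i => t (i - 1) := by
    ext y
    simp [Set.mem_pi]
  rw [this, coin_pi, Finset.prod_image fun _ _ _ _ h => Nat.succ_injective h]
  simp

lemma uniform_bool_singleton_le (s : Set Bool) (hs : s.Subsingleton) :
    (PMF.uniformOfFintype Bool).toMeasure s ≤ 2⁻¹ := by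
  rcases hs.eq_empty_or_singleton with rfl | ⟨b, rfl⟩
  · simp
  · rw [PMF.toMeasure_apply_singleton _ _ (measurableSet_singleton b)]
    simp

variable {g : Bool → Fin 6} (hg : ∀ b c, A (g b) (g c) = 1)

/-- The letter-by-letter coding of binary sequences by sequences over two symbols between which
all transitions are allowed. -/
def code (hg : ∀ b c, A (g b) (g c) = 1) (y : ℕ → Bool) : SFT A :=
  ⟨fun n => g (y n), fun _ => hg _ _⟩

lemma measurable_code : Measurable (code hg) :=
  Measurable.subtype_mk <| measurable_pi_lambda _ fun n =>
    (measurable_of_finite g).comp (measurable_pi_apply n)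

/-- The `(1/2, 1/2)`-Bernoulli measure on the full shift over the two symbols `g false`,
`g true`. -/
noncomputable def bernoulli (hg : ∀ b c, A (g b) (g c) = 1) : Measure (SFT A) :=
  coin.map (code hg)

instance : IsProbabilityMeasure (bernoulli hg) :=
  Measure.isProbabilityMeasure_map (measurable_code hg).aemeasurable

lemma bernoulli_mem_invMeasures : bernoulli hg ∈ invMeasures A := by
  refine ⟨inferInstance, measurable_shift, ?_⟩
  unfold bernoulli
  rw [Measure.map_map measurable_shift (measurable_code hg)]
  conv_rhs => rw [← measurePreserving_coin_shift.map_eq,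
    Measure.map_map (measurable_code hg) measurePreserving_coin_shift.measurable]
  rfl

lemma bernoulli_itinerary_le (hinj : Function.Injective g) (n : ℕ) (a : Fin n → Fin 6) :
    bernoulli hg (itinerary (shift A) (fun x => x.1 0) n ⁻¹' {a}) ≤ 2⁻¹ ^ n := by
  unfold bernoulli
  rw [Measure.map_apply (measurable_code hg)
    (measurable_itinerary measurable_shift (measurable_coord 0) n (measurableSet_singleton a))]
  let t : ℕ → Set Bool := fun i => {b | ∀ h : i < n, g b = a ⟨i, h⟩}
  have hsub : code hg ⁻¹' (itinerary (shift A) (fun x => x.1 0) n ⁻¹' {a}) ⊆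
      Set.pi (Finset.range n) t := by
    intro y hy i hi h
    have := congrFun (show itinerary (shift A) (fun x => x.1 0) n (code hg y) = a from hy) ⟨i, h⟩
    simpa [itinerary, shift_iterate_apply, code] using this
  refine (measure_mono hsub).trans ?_
  rw [coin_pi]
  calc _ ≤ ∏ _i ∈ Finset.range n, (2⁻¹ : ℝ≥0∞) := by
        refine Finset.prod_le_prod' fun i hi => uniform_bool_singleton_le _ ?_
        intro b hb c hc
        have hin := Finset.mem_range.1 hi
        exact hinj ((hb hin).trans (hc hin).symm)
    _ = _ := by simp

lemma rv_bernoulli : rv Φ (bernoulli hg) =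
    (1 / 4 : ℝ) • ∑ b, ∑ c, pairValue (g b, g c) := by
  have hY : Measurable fun y : ℕ → Bool => (y 0, y 1) :=
    (measurable_pi_apply 0).prodMk (measurable_pi_apply 1)
  have hcyl : ∀ p : Bool × Bool, coin.real ((fun y => (y 0, y 1)) ⁻¹' {p}) = 1 / 4 := by
    rintro ⟨b, c⟩
    have : ((fun y : ℕ → Bool => (y 0, y 1)) ⁻¹' {(b, c)}) =
        Set.pi (Finset.range 2) fun i => if i = 0 then {b} else {c} := by
      ext y
      simp [Finset.range_add_one, and_comm]
    rw [Measure.real, this, coin_pi]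
    simp only [Finset.prod_range_succ, Finset.prod_range_zero, one_mul, if_true, one_ne_zero,
      if_false, PMF.toMeasure_apply_singleton _ _ (measurableSet_singleton _)]
    simp
    norm_num
  ext i
  simp only [rv, Φ_eq, bernoulli]
  rw [integral_map (measurable_code hg).aemeasurable
    (measurable_pairValue_firstPair i).aestronglyMeasurable]
  change ∫ y : ℕ → Bool, pairValue (g (y 0), g (y 1)) i ∂coin = _
  rw [integral_comp_eq_sum hY fun p => pairValue (g p.1, g p.2) i]
  simp [hcyl, Fintype.sum_prod_type]

/-- A measure whose cylinders of length `n` have mass at most `2⁻ⁿ` has entropy at least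
`log 2`. -/
lemma log_two_le_metricEntropy {μ : Measure (SFT A)} [IsProbabilityMeasure μ]
    (h : ∀ (n : ℕ) (a : Fin n → Fin 6),
      μ (itinerary (shift A) (fun x => x.1 0) n ⁻¹' {a}) ≤ 2⁻¹ ^ n) :
    ENNReal.ofReal (Real.log 2) ≤ metricEntropy μ (shift A) := by
  refine le_trans ?_ (le_iSup₂_of_le 6 (fun x : SFT A => x.1 0)
    (le_iSup_of_le (measurable_coord 0) le_rfl))
  refine le_limsup_of_frequently_le' (Eventually.frequently ?_)
  filter_upwards [eventually_gt_atTop 0] with n hn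
  refine ENNReal.ofReal_le_ofReal ?_
  have hn' : (0 : ℝ) < n := by exact_mod_cast hn
  rw [le_div_iff₀ hn']
  have hone : ∑ a, μ.real (itinerary (shift A) (fun x => x.1 0) n ⁻¹' {a}) = 1 := by
    rw [sum_measureReal_preimage_singleton _ fun a _ =>
      measurable_itinerary measurable_shift (measurable_coord 0) n (measurableSet_singleton a)]
    simp
  calc Real.log 2 * n
      = ∑ a, μ.real (itinerary (shift A) (fun x => x.1 0) n ⁻¹' {a}) * (n * Real.log 2) := by
        rw [← Finset.sum_mul, hone]; ring
    _ ≤ _ := by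
        refine Finset.sum_le_sum fun a _ => ?_
        have hle := ENNReal.toReal_mono (by simp) (h n a)
        rw [← Measure.real, ENNReal.toReal_pow, ENNReal.toReal_inv, ENNReal.toReal_ofNat] at hle
        have hp : 0 ≤ μ.real (itinerary (shift A) (fun x => x.1 0) n ⁻¹' {a}) := measureReal_nonneg
        generalize μ.real (itinerary (shift A) (fun x => x.1 0) n ⁻¹' {a}) = p at hle hp ⊢
        rcases hp.eq_or_lt with h0 | h0
        · simp [← h0]
        · have := Real.log_le_log h0 hle
          rw [Real.log_pow, Real.log_inv] at this
          rw [Real.negMulLog, neg_mul, ← mul_neg]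
          exact mul_le_mul_of_nonneg_left (by linarith) h0.le

end Bernoulli

/-! ### Entropy at mixtures of Bernoulli measures -/

section LowerBound

/-- The value `log 2` is attained at convex combinations of the Bernoulli measures on the full
shifts over `{0, 1}` and `{3, 4}`, whose rotation vectors are `v₁` and `v₂`. -/
lemma log_two_le_localizedEntropy {t : ℝ} (h1 : 1 / 4 ≤ t) (h2 : t ≤ 3 / 4) :
    ENNReal.ofReal (Real.log 2) ≤ localizedEntropy Φ (baseLine t) := by
  have hlow : ∀ b c, A ((fun b => bif b then 1 else 0) b) ((fun b => bif b then 1 else 0) c) = 1 :=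
    by decide
  have hupp : ∀ b c, A ((fun b => bif b then 4 else 3) b) ((fun b => bif b then 4 else 3) c) = 1 :=
    by decide
  have hr1 : rv Φ (bernoulli hlow) = baseLine (1 / 4) := by
    rw [rv_bernoulli, baseLine_apply]
    ext i
    fin_cases i <;> simp [pairValue, pairs₁, pairs₂, w₁, w₂, w₃]
  have hr2 : rv Φ (bernoulli hupp) = baseLine (3 / 4) := by
    rw [rv_bernoulli, baseLine_apply]
    ext i
    fin_cases i <;> (simp [pairValue, pairs₁, pairs₂, w₁, w₂, w₃]; try norm_num)
  set a := 3 / 2 - 2 * t with ha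
  set b := 2 * t - 1 / 2 with hb
  have ha0 : 0 ≤ a := by linarith
  have hb0 : 0 ≤ b := by linarith
  have hab : a + b = 1 := by rw [ha, hb]; ring
  have hmem := convexComb_mem_invMeasures (bernoulli_mem_invMeasures hlow)
    (bernoulli_mem_invMeasures hupp) ha0 hb0 hab
  have := hmem.1
  refine le_trans (log_two_le_metricEntropy ?_) (le_iSup₂_of_le _ ⟨hmem, ?_⟩ le_rfl)
  · intro n c
    rw [Measure.add_apply, Measure.smul_apply, Measure.smul_apply, smul_eq_mul, smul_eq_mul]
    calc _ ≤ ENNReal.ofReal a * 2⁻¹ ^ n + ENNReal.ofReal b * 2⁻¹ ^ n := by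
          gcongr
          · exact bernoulli_itinerary_le hlow (by decide) n c
          · exact bernoulli_itinerary_le hupp (by decide) n c
      _ = 2⁻¹ ^ n := by
          rw [← add_mul, ← ENNReal.ofReal_add ha0 hb0, hab, ENNReal.ofReal_one, one_mul]
  · rw [rv_convexComb (fun i => integrable_Φ i) (fun i => integrable_Φ i) ha0 hb0, hr1, hr2,
      ← map_smul, ← map_smul, ← map_add]
    congr 1
    simp only [smul_eq_mul, ha, hb]
    ring

end LowerBound

/-! ### Failure of analyticity -/

section Analyticity

/-- By the identity theorem: the localized entropy is constant near the midpoint of the side, but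
not on the whole side. -/
lemma not_analyticOn_localizedEntropy :
    ¬ AnalyticOn ℝ (fun w => (localizedEntropy Φ w).toReal) (intrinsicInterior ℝ F) := by
  intro hana
  let f : ℝ → ℝ := fun t => (localizedEntropy Φ (baseLine t)).toReal
  have hf : AnalyticOnNhd ℝ f (Set.Ioo 0 1) := by
    rw [← isOpen_Ioo.analyticOn_iff_analyticOnNhd]
    exact hana.comp (baseLine.toContinuousLinearMap.analyticOn _)
      (Set.mapsTo_iff_image_subset.2 baseLine_Ioo_subset_intrinsicInterior)
  have heq : f =ᶠ[𝓝 (1 / 2)] fun _ => Real.log 2 := by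
    filter_upwards [Icc_mem_nhds (by norm_num : (1 / 4 : ℝ) < 1 / 2)
      (by norm_num : (1 / 2 : ℝ) < 3 / 4)] with t ht
    simp only [f]
    rw [le_antisymm (localizedEntropy_le_log_two t) (log_two_le_localizedEntropy ht.1 ht.2),
      ENNReal.toReal_ofReal (Real.log_nonneg one_le_two)]
  have h8 : f (1 / 8) = Real.log 2 :=
    hf.eqOn_of_preconnected_of_eventuallyEq analyticOnNhd_const isPreconnected_Ioo
      (by norm_num) heq (by norm_num)
  have hlt := localizedEntropy_lt_log_two (t := 1 / 8) (by norm_num) (by norm_num)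
    (Or.inl (by norm_num))
  have := (ENNReal.toReal_lt_toReal hlt.ne_top ENNReal.ofReal_ne_top).2 hlt
  rw [ENNReal.toReal_ofReal (Real.log_nonneg one_le_two)] at this
  exact this.ne h8

end Analyticity

end RotEntropy

open RotEntropy in
theorem mainTheorem7 :
    RotEntropy.Rot RotEntropy.Φ = RotEntropy.triangle ∧
    RotEntropy.IsFace (RotEntropy.Rot RotEntropy.Φ) RotEntropy.F ∧
    (∀ w ∈ segment ℝ RotEntropy.v₁ RotEntropy.v₂,
      RotEntropy.localizedEntropy RotEntropy.Φ w = ENNReal.ofReal (Real.log 2)) ∧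
    (∀ w ∈ RotEntropy.F \ segment ℝ RotEntropy.v₁ RotEntropy.v₂,
      RotEntropy.localizedEntropy RotEntropy.Φ w < ENNReal.ofReal (Real.log 2)) ∧
    ¬ AnalyticOn ℝ (fun w => (RotEntropy.localizedEntropy RotEntropy.Φ w).toReal)
      (intrinsicInterior ℝ RotEntropy.F) := by
  refine ⟨Rot_Φ_eq_triangle, Rot_Φ_eq_triangle ▸ isFace_triangle_F, ?_, ?_, ?_⟩
  · rw [segment_v_eq_image]
    rintro _ ⟨t, ht, rfl⟩
    exact le_antisymm (localizedEntropy_le_log_two t) (log_two_le_localizedEntropy ht.1 ht.2)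
  · rw [segment_v_eq_image, F_eq_image]
    rintro _ ⟨⟨t, ht, rfl⟩, hn⟩
    refine localizedEntropy_lt_log_two ht.1 ht.2 ?_
    by_contra! hcon
    exact hn ⟨t, hcon, rfl⟩
  · exact not_analyticOn_localizedEntropy
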